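/- Let $K$ be a field of characteristic $0$ (for instance $\mathbb R$ or $\mathbb C$), let $U$ be a $K$-vector space of finite dimension $s$, let $V=U^*$ be its dual, and let $X=(a_1,\dots,a_N)$ be a list of non-zero vectors of $V$, repetitions allowed, which spans $V$. Let $S[U]=\bigoplus_{k\ge 0}S^k[U]$ be the symmetric algebra of $U$, i.e. the graded algebra of polynomial functions on $V$, and for $v\in V$ let $D_v$ be the directional derivative, i.e. the derivation of $S[U]$ with $D_v(\varphi)=\langle\varphi\,|\,v\rangle$ for $\varphi\in U$. A sublist $Y$ of $X$ is a \emph{cocircuit} if the elements of $X-Y$ do not span $V$. Put $D_Y:=\prod_{a\in Y}D_a$ and $$D(X):=\{p\in S[U]\ |\ D_Yp=0\ \text{ for all cocircuits } Y\},\qquad D_k(X):=D(X)\cap S^k[U],\qquad H_X(q):=\sum_{k\ge 0}\dim_K D_k(X)\,q^k .$$ Let $\mathcal B(X)$ be the set of bases $\underline b=(a_{i_1},\dots,a_{i_s})$, $i_1<\dots<i_s$, of $V$ extracted from $X$ (as sublists, i.e. sets of positions). The element $a_i$ of $X$ \emph{breaks} $\underline b$ if there is an index $1\le e\le s$ such that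 $i\le i_e$ and $a_i$ is a linear combination of $a_{i_e},\dots,a_{i_s}$. Let $n(\underline b)$ be the number of indices $i\in\{1,\dots,N\}$ such that $a_i$ breaks $\underline b$. Then $D(X)$ is finite dimensional, $D(X)=\bigoplus_{k\ge0}D_k(X)$, and $$H_X(q)=\sum_{\underline b\in\mathcal B(X)}q^{N-n(\underline b)} .$$ In particular $s\le N$ and the top degree of $D(X)$ is $N-s$: $D_{N-s}(X)\ne 0$, and $D_k(X)=0$ for all $k>N-s$. -/

import Mathlib

namespace DahmenMicchelli

noncomputable section

/-! Throughout `U` is a `K`-vector space, `V = Module.Dual K U`, and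
`S[U] = SymmetricAlgebra K U` is the algebra of polynomial functions on `V`. -/

section Polynomials

variable {K U : Type*} [Field K] [AddCommGroup U] [Module K U]

/-- The algebra homomorphism `S[U] → S[U][ε]`, `φ ↦ φ + ⟨φ | v⟩ ε` for `φ ∈ U`
(first order Taylor expansion in the direction `v`). -/
def taylorHom (v : Module.Dual K U) :
    SymmetricAlgebra K U →ₐ[K] TrivSqZeroExt (SymmetricAlgebra K U) (SymmetricAlgebra K U) :=
  SymmetricAlgebra.lift
    { toFun := fun φ =>
        TrivSqZeroExt.inl (SymmetricAlgebra.ι K U φ) +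
          TrivSqZeroExt.inr (v φ • (1 : SymmetricAlgebra K U))
      map_add' := fun φ ψ => by
        ext <;> simp [add_smul]
      map_smul' := fun c φ => by
        ext <;> simp [mul_smul] }

theorem taylorHom_ι (v : Module.Dual K U) (φ : U) :
    taylorHom v (SymmetricAlgebra.ι K U φ) =
      TrivSqZeroExt.inl (SymmetricAlgebra.ι K U φ) +
        TrivSqZeroExt.inr (v φ • (1 : SymmetricAlgebra K U)) := by
  simp [taylorHom]

theorem fst_taylorHom (v : Module.Dual K U) (p : SymmetricAlgebra K U) :
    (taylorHom v p).fst = p := by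
  induction p using SymmetricAlgebra.induction with
  | algebraMap r => simp [AlgHom.commutes, TrivSqZeroExt.algebraMap_eq_inl']
  | ι φ => simp [taylorHom_ι]
  | mul a b ha hb => simp [ha, hb]
  | add a b ha hb => simp [ha, hb]

/-- The directional derivative `D_v` on `S[U]`: the `K`-linear derivation whose value on
`φ ∈ U` is the constant `⟨φ | v⟩`. -/
def dirDeriv (v : Module.Dual K U) :
    Derivation K (SymmetricAlgebra K U) (SymmetricAlgebra K U) where
  toFun p := (taylorHom v p).snd
  map_add' p q := by simp
  map_smul' c p := by simp
  map_one_eq_zero' := by simp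
  leibniz' p q := by
    simp [fst_taylorHom, mul_comm]

theorem dirDeriv_ι (v : Module.Dual K U) (φ : U) :
    dirDeriv v (SymmetricAlgebra.ι K U φ) = algebraMap K (SymmetricAlgebra K U) (v φ) := by
  change (taylorHom v _).snd = _
  simp [taylorHom_ι, Algebra.algebraMap_eq_smul_one]

theorem dirDeriv_comm (v w : Module.Dual K U) (p : SymmetricAlgebra K U) :
    dirDeriv v (dirDeriv w p) = dirDeriv w (dirDeriv v p) := by
  induction p using SymmetricAlgebra.induction with
  | algebraMap r => simp
  | ι φ => simp [dirDeriv_ι]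
  | mul a b ha hb =>
    simp only [Derivation.leibniz, map_add, smul_eq_mul, ha, hb]
    ring
  | add a b ha hb => simp [ha, hb]

/-- `D_v` as a `K`-linear endomorphism of `S[U]`. -/
def dirDerivEnd (v : Module.Dual K U) : Module.End K (SymmetricAlgebra K U) :=
  (dirDeriv v : SymmetricAlgebra K U →ₗ[K] SymmetricAlgebra K U)

theorem commute_dirDerivEnd (v w : Module.Dual K U) :
    Commute (dirDerivEnd v) (dirDerivEnd w) :=
  LinearMap.ext fun p => dirDeriv_comm v w p

variable (K U) in
/-- The homogeneous polynomials of degree `k` on `V`: the span `S^k[U]` of all products of `k`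
elements of `U`. -/
def homogeneousPart (k : ℕ) : Submodule K (SymmetricAlgebra K U) :=
  LinearMap.range (SymmetricAlgebra.ι K U) ^ k

end Polynomials

section Lists

/-! A list `a_1, …, a_N` of vectors of `V` is a map `a : Fin N → V`, repetitions allowed.
A sublist is given by the set of its positions, a `Finset (Fin N)`. -/

variable {K V : Type*} [Field K] [AddCommGroup V] [Module K V] {N : ℕ}

/-- The sublist `Y` is a cocircuit: the remaining vectors do not span `V`. -/
def IsCocircuit (a : Fin N → V) (Y : Finset (Fin N)) : Prop :=
  Submodule.span K (a '' {i | i ∉ Y}) ≠ ⊤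

/-- The sublist `b` is a basis of `V`. -/
def IsBasisOf (a : Fin N → V) (b : Finset (Fin N)) : Prop :=
  LinearIndependent K (fun i : b => a i) ∧ Submodule.span K (a '' {i | i ∈ b}) = ⊤

/-- `a_i` breaks the sublist `c`: for some position `e` of `c` with `i ≤ e`, the vector `a_i` is
linearly dependent on the vectors of `c` at positions `≥ e`. -/
def Breaks (a : Fin N → V) (c : Finset (Fin N)) (i : Fin N) : Prop :=
  ∃ e ∈ c, i ≤ e ∧ a i ∈ Submodule.span K (a '' {j | j ∈ c ∧ e ≤ j})

open Classical in
variable (K) in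
/-- The set of all bases of `V` extracted from the list. -/
def bases (a : Fin N → V) : Finset (Finset (Fin N)) :=
  Finset.univ.filter fun b => IsBasisOf (K := K) a b

open Classical in
variable (K) in
/-- `n(b)`: the number of elements of the list that break `b`. -/
def breakCount (a : Fin N → V) (b : Finset (Fin N)) : ℕ :=
  (Finset.univ.filter fun i => Breaks (K := K) a b i).card

end Lists

section TheSpace

variable {K U : Type*} [Field K] [AddCommGroup U] [Module K U] {N : ℕ}

/-- The differential operator `D_Y`, the product of the derivatives `D_{a_i}`, `i ∈ Y`. -/
def diffOp (a : Fin N → Module.Dual K U) (Y : Finset (Fin N)) :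
    Module.End K (SymmetricAlgebra K U) :=
  Y.noncommProd (fun i => dirDerivEnd (a i)) fun _ _ _ _ _ => commute_dirDerivEnd _ _

/-- The space `D(X)` of the polynomials `p` on `V` with `D_Y p = 0` for all cocircuits `Y`. -/
def DSpace (a : Fin N → Module.Dual K U) : Submodule K (SymmetricAlgebra K U) where
  carrier := {p | ∀ Y : Finset (Fin N), IsCocircuit (K := K) a Y → diffOp a Y p = 0}
  add_mem' hp hq Y hY := by rw [map_add, hp Y hY, hq Y hY, add_zero]
  zero_mem' Y _ := map_zero _
  smul_mem' c p hp Y hY := by rw [map_smul, hp Y hY, smul_zero]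

/-- The degree `k` part `D_k(X)` of `D(X)`, as a subspace of `D(X)`. -/
def DSpacePart (a : Fin N → Module.Dual K U) (k : ℕ) : Submodule K (DSpace a) :=
  (homogeneousPart K U k).comap (DSpace a).subtype

/-- The Hilbert series `∑ₖ dim D_k(X) q^k`. -/
def hilbertSeries (a : Fin N → Module.Dual K U) : PowerSeries ℕ :=
  PowerSeries.mk fun k => Module.finrank K (DSpacePart a k)

end TheSpace

end

end DahmenMicchelli

/-! The number of bases bounds `dim D(X)` from above, degree by degree, and from below in total;
equality follows in every degree.

Upper bound (`eq_zero_of_forall_basis`): for a basis `b`, let `Y_b` be the set of positions that do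
not break `b`. An element `p` of `D(X)` is zero as soon as every `D_{Y_b} p` has zero constant term.
This is a deletion-contraction induction on the last vector `a_n`: the derivative of `p` along `a_n`
satisfies the equations of the list without `a_n`, and if it vanishes then `p` satisfies those of
the list contracted by `a_n`. Bases avoiding or containing `n` serve the two cases. If `p` is
homogeneous of degree `k`, only bases with `|Y_b| = N - n(b) = k` contribute, so `dim D_k(X)` is at
most their number.

Lower bound (`card_bases_le_sum_finrank`): for generic constants `c_i`, the equations `a_i = c_i`
with `i ∈ b` have one solution `u_b` for each basis `b`, and these points are distinct. A cocircuit
`Y` meets every basis, so `∏_{i ∈ Y} (D_{a_i} - c_i)` kills every `exp(u_b)`. The least-degree part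
of a combination of these exponentials is then killed by `D_Y`, hence lies in `D(X)`. The
exponentials are linearly independent, and filtering their span by order of vanishing shows that the
sum of the `dim D_k(X)` is at least the number of bases.

The top degree is reached at the greedy basis, which is broken by its own elements only. -/

namespace DahmenMicchelli

open SymmetricAlgebra

/-! ### The grading of the symmetric algebra and directional derivatives. -/

section Grading

variable {K U : Type*} [Field K] [AddCommGroup U] [Module K U]

variable (K U) in
/-- The algebra homomorphism `S[U] → S[U][T]`, `φ ↦ φ T` for `φ ∈ U`. -/
noncomputable def gradHom : SymmetricAlgebra K U →ₐ[K] Polynomial (SymmetricAlgebra K U) :=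
  SymmetricAlgebra.lift
    (((Polynomial.monomial 1).restrictScalars K) ∘ₗ SymmetricAlgebra.ι K U)

theorem gradHom_ι (φ : U) :
    gradHom K U (ι K U φ) = Polynomial.monomial 1 (ι K U φ) := by
  simp [gradHom]

theorem gradHom_of_mem_homogeneousPart {k : ℕ} {p : SymmetricAlgebra K U}
    (hp : p ∈ homogeneousPart K U k) : gradHom K U p = Polynomial.monomial k p := by
  induction hp using Submodule.pow_induction_on_left' with
  | algebraMap r => simp [Polynomial.algebraMap_apply]
  | add x y i hx hy ihx ihy => simp [ihx, ihy]
  | mem_mul m hm i x hx ih =>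
    obtain ⟨φ, rfl⟩ := hm
    rw [map_mul, ih, gradHom_ι, Polynomial.monomial_mul_monomial, add_comm]

theorem eval_one_gradHom (p : SymmetricAlgebra K U) : (gradHom K U p).eval 1 = p := by
  induction p using SymmetricAlgebra.induction with
  | algebraMap r => simp [Polynomial.algebraMap_apply]
  | ι φ => simp [gradHom_ι]
  | mul a b ha hb => simp [ha, hb]
  | add a b ha hb => simp [ha, hb]

theorem coeff_zero_gradHom (p : SymmetricAlgebra K U) :
    (gradHom K U p).coeff 0 = algebraMap K _ (algebraMapInv p) := by
  induction p using SymmetricAlgebra.induction with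
  | algebraMap r => simp [Polynomial.algebraMap_apply]
  | ι φ => rw [algebraMapInv_ι]; simp [gradHom_ι, Polynomial.coeff_monomial]
  | mul a b ha hb => simp [ha, hb, Polynomial.mul_coeff_zero]
  | add a b ha hb => simp [ha, hb]

theorem algebraMapInv_of_mem_homogeneousPart {k : ℕ} (hk : k ≠ 0) {p : SymmetricAlgebra K U}
    (hp : p ∈ homogeneousPart K U k) : algebraMapInv p = 0 := by
  have h := coeff_zero_gradHom p
  rw [gradHom_of_mem_homogeneousPart hp, Polynomial.coeff_monomial, if_neg hk] at h
  exact (algebraMap_eq_zero_iff (M := U) _).1 h.symm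

/-- Euler's identity with the scaling variable `T` kept: the chain rule for `p` with its argument
scaled by `T`. -/
theorem derivative_gradHom {κ : Type*} [Fintype κ] (b : Module.Basis κ K U)
    (p : SymmetricAlgebra K U) :
    Polynomial.derivative (gradHom K U p) =
      ∑ i, Polynomial.C (ι K U (b i)) * gradHom K U (dirDeriv (b.coord i) p) := by
  induction p using SymmetricAlgebra.induction with
  | algebraMap r => simp [Polynomial.algebraMap_apply]
  | ι φ =>
    simp only [gradHom_ι, Polynomial.derivative_monomial, dirDeriv_ι, AlgHom.commutes]
    conv_lhs => rw [← b.sum_repr φ]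
    simp only [map_sum, map_smul, Finset.sum_mul, Algebra.smul_def, Polynomial.algebraMap_apply,
      Module.Basis.coord_apply]
    simp [mul_comm]
  | mul x y hx hy =>
    simp only [map_mul, Polynomial.derivative_mul, hx, hy, Derivation.leibniz, smul_eq_mul,
      map_add, Finset.sum_mul, Finset.mul_sum, ← Finset.sum_add_distrib]
    exact Finset.sum_congr rfl fun i _ => by ring
  | add x y hx hy => simp [hx, hy, mul_add, Finset.sum_add_distrib]

theorem dirDeriv_add (v w : Module.Dual K U) (p : SymmetricAlgebra K U) :
    dirDeriv (v + w) p = dirDeriv v p + dirDeriv w p := by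
  induction p using SymmetricAlgebra.induction with
  | algebraMap r => simp
  | ι φ => simp [dirDeriv_ι]
  | mul x y hx hy => simp only [Derivation.leibniz, hx, hy, smul_eq_mul]; ring
  | add x y hx hy => simp only [map_add, hx, hy]; abel

theorem dirDeriv_smul (t : K) (v : Module.Dual K U) (p : SymmetricAlgebra K U) :
    dirDeriv (t • v) p = t • dirDeriv v p := by
  induction p using SymmetricAlgebra.induction with
  | algebraMap r => simp
  | ι φ => simp [dirDeriv_ι, Algebra.smul_def]
  | mul x y hx hy => simp only [Derivation.leibniz, hx, hy, smul_eq_mul, mul_smul_comm, smul_add]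
  | add x y hx hy => simp only [map_add, hx, hy, smul_add]

theorem dirDeriv_zero (p : SymmetricAlgebra K U) : dirDeriv (0 : Module.Dual K U) p = 0 := by
  simpa using dirDeriv_smul (0 : K) 0 p

/-- In characteristic zero, a polynomial all of whose directional derivatives vanish is constant. -/
theorem eq_algebraMap_of_forall_dirDeriv_eq_zero [CharZero K] [FiniteDimensional K U]
    {p : SymmetricAlgebra K U} (hp : ∀ v : Module.Dual K U, dirDeriv v p = 0) :
    p = algebraMap K _ (algebraMapInv p) := by
  have hd : Polynomial.derivative (gradHom K U p) = 0 := by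
    rw [derivative_gradHom (Module.finBasis K U)]
    simp [hp]
  have : IsAddTorsionFree (SymmetricAlgebra K U) := 
    ⟨fun n hn x y h => by
      have h' : (n : K) • x = (n : K) • y := by simpa only [Nat.cast_smul_eq_nsmul] using h
      exact smul_right_injective _ (Nat.cast_ne_zero.2 hn) h'⟩
  have h := Polynomial.eq_C_of_natDegree_eq_zero
    (Polynomial.derivative_eq_zero.1 hd)
  rw [coeff_zero_gradHom] at h
  have h1 := eval_one_gradHom p
  rw [h, Polynomial.eval_C] at h1
  exact h1.symm

theorem dirDeriv_mem_homogeneousPart (v : Module.Dual K U) {k : ℕ} {p : SymmetricAlgebra K U}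
    (hp : p ∈ homogeneousPart K U (k + 1)) : dirDeriv v p ∈ homogeneousPart K U k := by
  -- Truncated subtraction lets the induction start at degree `0`, where the derivative is zero.
  suffices h : ∀ m, ∀ p ∈ homogeneousPart K U m, dirDeriv v p ∈ homogeneousPart K U (m - 1) from
    h _ _ hp
  clear hp p k
  intro k p hp
  induction hp using Submodule.pow_induction_on_left' with
  | algebraMap r => simp
  | add x y i hx hy ihx ihy => rw [map_add]; exact add_mem ihx ihy
  | mem_mul m hm i x hx ih =>
    obtain ⟨φ, rfl⟩ := hm
    rw [Derivation.leibniz, dirDeriv_ι, smul_eq_mul, smul_eq_mul, Nat.succ_sub_one]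
    refine add_mem ?_ ?_
    · rcases i with _ | i
      · obtain ⟨r, rfl⟩ := Submodule.mem_one.1 (by simpa using hx)
        simp
      · rw [homogeneousPart, pow_succ']
        exact Submodule.mul_mem_mul ⟨φ, rfl⟩ ih
    · rw [mul_comm, ← Algebra.smul_def]
      exact Submodule.smul_mem _ _ hx

theorem dirDeriv_eq_zero_of_mem_homogeneousPart_zero (v : Module.Dual K U)
    {p : SymmetricAlgebra K U} (hp : p ∈ homogeneousPart K U 0) : dirDeriv v p = 0 := by
  obtain ⟨r, rfl⟩ := Submodule.mem_one.1 (by simpa [homogeneousPart] using hp)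
  simp

/-- A finite sum of homogeneous polynomials of distinct degrees vanishes only if all of them
vanish. -/
theorem iSupIndep_homogeneousPart : iSupIndep (homogeneousPart K U) := by
  rw [iSupIndep_iff_finsetSum_eq_zero_imp_eq_zero]
  intro s v hv h0 i hi
  have h := congrArg (fun p => (gradHom K U p).coeff i) h0
  simp only [map_sum, map_zero, Polynomial.coeff_zero, Polynomial.finsetSum_coeff] at h
  rw [Finset.sum_congr rfl fun j hj => by
    rw [gradHom_of_mem_homogeneousPart (hv j hj), Polynomial.coeff_monomial]] at h
  simpa [hi] using h

end Grading

/-! ### The operators `D_Y` and degrees. -/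

section DiffOp

variable {K U : Type*} [Field K] [AddCommGroup U] [Module K U] {N : ℕ}
  (a : Fin N → Module.Dual K U)

theorem diffOp_empty (p : SymmetricAlgebra K U) : diffOp a ∅ p = p := by
  rfl

theorem diffOp_insert {i : Fin N} {Y : Finset (Fin N)} (hi : i ∉ Y) (p : SymmetricAlgebra K U) :
    diffOp a (insert i Y) p = dirDeriv (a i) (diffOp a Y p) := by
  exact LinearMap.congr_fun (Finset.noncommProd_insert_of_notMem Y i
    (fun i => dirDerivEnd (a i)) (fun _ _ _ _ _ => commute_dirDerivEnd _ _) hi) p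

theorem diffOp_insert' {i : Fin N} {Y : Finset (Fin N)} (hi : i ∉ Y)
    (p : SymmetricAlgebra K U) :
    diffOp a (insert i Y) p = diffOp a Y (dirDeriv (a i) p) := by
  exact LinearMap.congr_fun (Finset.noncommProd_insert_of_notMem' Y i
    (fun i => dirDerivEnd (a i)) (fun _ _ _ _ _ => commute_dirDerivEnd _ _) hi) p

theorem diffOp_mem_homogeneousPart {k : ℕ} {p : SymmetricAlgebra K U} (Y : Finset (Fin N))
    (hp : p ∈ homogeneousPart K U (k + Y.card)) : diffOp a Y p ∈ homogeneousPart K U k := by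
  induction Y using Finset.induction_on generalizing k with
  | empty => simpa [diffOp_empty] using hp
  | insert i Y hi ih =>
    rw [diffOp_insert a hi]
    refine dirDeriv_mem_homogeneousPart _ (ih ?_)
    rwa [Finset.card_insert_of_notMem hi, add_comm Y.card 1, ← add_assoc] at hp

/-- The first `k` derivatives leave a constant, which any further derivative kills. -/
theorem diffOp_eq_zero_of_lt_card {k : ℕ} {p : SymmetricAlgebra K U} {Y : Finset (Fin N)}
    (hk : k < Y.card) (hp : p ∈ homogeneousPart K U k) : diffOp a Y p = 0 := by
  obtain ⟨Z, hZ, hcard⟩ := Finset.exists_subset_card_eq hk.le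
  obtain ⟨i, hiY, hiZ⟩ := Finset.exists_mem_notMem_of_card_lt_card (hcard.trans_lt hk)
  have h0 : diffOp a Z p ∈ homogeneousPart K U 0 :=
    diffOp_mem_homogeneousPart a Z (by simpa [hcard] using hp)
  have key : ∀ W : Finset (Fin N), insert i Z ⊆ W → diffOp a W p = 0 := by
    intro W hW
    induction W using Finset.strongInduction with
    | H W ih =>
      rcases hW.eq_or_ssubset with rfl | hss
      · rw [diffOp_insert a hiZ, dirDeriv_eq_zero_of_mem_homogeneousPart_zero _ h0]
      · obtain ⟨j, hjW, hj⟩ := Finset.exists_of_ssubset hss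
        rw [← Finset.insert_erase hjW, diffOp_insert a (Finset.notMem_erase j W),
          ih _ (Finset.erase_ssubset hjW) (Finset.subset_erase.2 ⟨hW, hj⟩), map_zero]
  exact key Y (Finset.insert_subset hiY hZ)

end DiffOp

end DahmenMicchelli

namespace DahmenMicchelli

open SymmetricAlgebra

/-! ### Bases, breaking positions and the greedy basis. -/

section Lists

variable {K V : Type*} [Field K] [AddCommGroup V] [Module K V]

theorem mem_span_image_of_subset {κ : Type*} {a : κ → V} {s t : Set κ} {v : V}
    (hv : v ∈ Submodule.span K (a '' s)) (h : ∀ i ∈ s, i ∈ t) :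
    v ∈ Submodule.span K (a '' t) :=
  Submodule.span_mono (Set.image_mono h) hv

theorem linearIndepOn_of_notMem_span_gt {κ : Type*} [LinearOrder κ] (a : κ → V) (c : Finset κ)
    (h : ∀ i ∈ c, a i ∉ Submodule.span K (a '' {j | j ∈ c ∧ i < j})) :
    LinearIndepOn K a (c : Set κ) := by
  induction c using Finset.induction_on_min with
  | empty => simp
  | insert i c hi ih =>
    have hic : i ∉ c := fun h => lt_irrefl i (hi i h)
    rw [Finset.coe_insert, linearIndepOn_insert (by simpa using hic)]
    refine ⟨ih fun j hj hmem => h j (Finset.mem_insert_of_mem hj) ?_, fun hmem =>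
      h i (Finset.mem_insert_self i c) ?_⟩
    · exact mem_span_image_of_subset hmem fun l hl => ⟨Finset.mem_insert_of_mem hl.1, hl.2⟩
    · exact mem_span_image_of_subset hmem fun l hl => ⟨Finset.mem_insert_of_mem hl, hi l hl⟩

variable {N : ℕ} {a : Fin N → V}

/-- The least position of `c` that is `≥ i` serves as `e`; one exists because a nonzero `a i` is not
in the span of the empty set. -/
theorem breaks_iff_mem_span {c : Finset (Fin N)} {i : Fin N} (hi : a i ≠ 0) :
    Breaks (K := K) a c i ↔ a i ∈ Submodule.span K (a '' {j | j ∈ c ∧ i ≤ j}) := by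
  constructor
  · rintro ⟨e, -, hie, hmem⟩
    exact mem_span_image_of_subset hmem fun j hj => ⟨hj.1, hie.trans hj.2⟩
  · intro hmem
    have hne : (c.filter (i ≤ ·)).Nonempty := by
      rw [Finset.nonempty_iff_ne_empty]
      intro h0
      have : {j | j ∈ c ∧ i ≤ j} = (∅ : Set (Fin N)) := by
        simpa [Set.ext_iff, Finset.ext_iff] using h0
      rw [this] at hmem
      exact hi (by simpa using hmem)
    have hmin := Finset.mem_filter.1 ((c.filter (i ≤ ·)).min'_mem hne)
    exact ⟨_, hmin.1, hmin.2, mem_span_image_of_subset hmem fun j hj =>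
      ⟨hj.1, Finset.min'_le _ _ (Finset.mem_filter.2 hj)⟩⟩

theorem breaks_of_mem {c : Finset (Fin N)} {i : Fin N} (hi : i ∈ c) : Breaks (K := K) a c i :=
  ⟨i, hi, le_rfl, Submodule.subset_span ⟨i, ⟨hi, le_rfl⟩, rfl⟩⟩

open Classical in
variable (K) in
/-- The positions whose elements do not break `c`. -/
noncomputable def nonBreaking (a : Fin N → V) (c : Finset (Fin N)) : Finset (Fin N) :=
  Finset.univ.filter fun i => ¬ Breaks (K := K) a c i

theorem card_nonBreaking (c : Finset (Fin N)) :
    (nonBreaking K a c).card = N - breakCount K a c := by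
  classical
  have h := Finset.card_filter_add_card_filter_not (s := (Finset.univ : Finset (Fin N)))
    (fun i => Breaks (K := K) a c i)
  rw [Finset.card_univ, Fintype.card_fin] at h
  unfold nonBreaking breakCount
  omega

theorem mem_bases {b : Finset (Fin N)} : b ∈ bases K a ↔ IsBasisOf (K := K) a b := by
  simp [bases]

theorem IsBasisOf.card_eq {b : Finset (Fin N)} (hb : IsBasisOf (K := K) a b) :
    b.card = Module.finrank K V := by
  have h : Submodule.span K (Set.range fun i : b => a i) = ⊤ := by
    rw [← hb.2]
    congr 1
    ext v
    simp
  have := Module.finrank_eq_card_basis (Module.Basis.mk hb.1 h.ge)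
  simpa using this.symm

theorem card_le_breakCount (b : Finset (Fin N)) : b.card ≤ breakCount K a b := by
  classical
  exact Finset.card_le_card fun i hi => Finset.mem_filter.2 ⟨Finset.mem_univ i, breaks_of_mem hi⟩

/-- The greedy basis is broken by its own elements only. -/
theorem exists_isBasisOf_breakCount_eq (h0 : ∀ i, a i ≠ 0)
    (ha : Submodule.span K (Set.range a) = ⊤) :
    ∃ b, IsBasisOf (K := K) a b ∧ breakCount K a b = b.card := by
  classical
  let b : Finset (Fin N) := Finset.univ.filter fun i => a i ∉ Submodule.span K (a '' {j | j < i})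
  have hmem : ∀ i, i ∈ b ↔ a i ∉ Submodule.span K (a '' {j | j < i}) := fun i => by simp [b]
  have hspan : ∀ i, a i ∈ Submodule.span K (a '' {j | j ∈ b ∧ j ≤ i}) := by
    intro i
    induction i using WellFoundedLT.induction with
    | ind i ih =>
      by_cases hi : i ∈ b
      · exact Submodule.subset_span ⟨i, ⟨hi, le_rfl⟩, rfl⟩
      · rw [hmem, not_not] at hi
        refine Submodule.span_le.2 ?_ hi
        rintro _ ⟨j, hj, rfl⟩
        exact mem_span_image_of_subset (ih j hj) fun l hl => ⟨hl.1, hl.2.trans (le_of_lt hj)⟩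
  have hli : LinearIndepOn K a (b : Set (Fin N)) := by
    -- Reversing the order turns "later" into "earlier".
    have := linearIndepOn_of_notMem_span_gt (K := K) (κ := (Fin N)ᵒᵈ) a b fun i hi hm =>
      (hmem i).1 hi (mem_span_image_of_subset hm fun j hj => hj.2)
    exact this
  refine ⟨b, ⟨hli, ?_⟩, ?_⟩
  · rw [eq_top_iff, ← ha, Submodule.span_le]
    rintro _ ⟨i, rfl⟩
    exact mem_span_image_of_subset (hspan i) fun j hj => hj.1
  · refine congrArg Finset.card (Finset.ext fun i => ?_)
    rw [Finset.mem_filter]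
    refine ⟨fun h => ?_, fun h => ⟨Finset.mem_univ i, breaks_of_mem h⟩⟩
    -- If `i ∉ b` broke `b`, then `a i` would lie in the spans of two disjoint parts of an
    -- independent family, forcing `a i = 0`.
    by_contra hib
    have h1 := (breaks_iff_mem_span (h0 i)).1 h.2
    have h2 := hspan i
    have hdisj : Disjoint {j | j ∈ b ∧ j ≤ i} {j | j ∈ b ∧ i ≤ j} := by
      rw [Set.disjoint_left]
      rintro j ⟨hj, hji⟩ ⟨-, hij⟩
      exact hib (le_antisymm hji hij ▸ hj)
    have hd : LinearIndepOn K a ({j | j ∈ b ∧ j ≤ i} ∪ {j | j ∈ b ∧ i ≤ j}) :=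
      hli.mono (by rintro j (hj | hj) <;> exact hj.1)
    rw [linearIndepOn_union_iff hdisj] at hd
    exact h0 i (Submodule.disjoint_def.1 hd.2.2 _ h2 h1)

end Lists

/-! ### Upper bound by deletion and contraction. -/

section UpperBound

variable {K U : Type*} [Field K] [AddCommGroup U] [Module K U] {N : ℕ}

open Classical in
/-- Relative version of the injectivity of `p ↦ (ε (D_{Y_c} p))_c`: the list is restricted to the
positions in `s`, and the subspace `W` is contracted. -/
theorem eq_zero_of_forall_relative_basis [CharZero K] [FiniteDimensional K U]
    (a : Fin N → Module.Dual K U) (s : Finset (Fin N)) :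
    ∀ (W : Submodule K (Module.Dual K U)) (p : SymmetricAlgebra K U),
    (∀ w ∈ W, dirDeriv w p = 0) →
    (∀ Y ⊆ s, W ⊔ Submodule.span K (a '' {i | i ∈ s ∧ i ∉ Y}) ≠ ⊤ → diffOp a Y p = 0) →
    (∀ c ⊆ s, (∀ i ∈ c, a i ∉ W ⊔ Submodule.span K (a '' {j | j ∈ c ∧ i < j})) →
      W ⊔ Submodule.span K (a '' {j | j ∈ c}) = ⊤ →
      algebraMapInv (diffOp a
        (s.filter fun i => a i ∉ W ⊔ Submodule.span K (a '' {j | j ∈ c ∧ i ≤ j})) p) = 0) →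
    p = 0 := by
  induction s using Finset.induction_on_max with
  | empty =>
    intro W p hW hY hc
    -- If `W` is everything, `p` is constant and the empty basis reads off its value; otherwise the
    -- empty set is a cocircuit.
    by_cases hWt : W = ⊤
    · have h := hc ∅ (Finset.Subset.refl _) (by simp) (by simp [hWt])
      rw [Finset.filter_empty, diffOp_empty] at h
      rw [eq_algebraMap_of_forall_dirDeriv_eq_zero fun v => hW v (hWt ▸ Submodule.mem_top), h,
        map_zero]
    · simpa [diffOp_empty] using hY ∅ (Finset.Subset.refl _) (by simpa using hWt)
  | insert n s hn ih =>
    intro W p hW hY hc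
    have hns : n ∉ s := fun h => lt_irrefl n (hn n h)
    -- Deletion. A relative basis `c ⊆ s` has no position `≥ n`, so `n` does not break it when `a n
    -- ∉ W`: the factor `D_{a_n}` occurs in the operator of `c`.
    have hq : dirDeriv (a n) p = 0 := by
      by_cases haW : a n ∈ W
      · exact hW _ haW
      refine ih W _ (fun w hw => by rw [dirDeriv_comm, hW w hw, map_zero]) ?_ ?_
      · intro Y hYs hne
        rw [← diffOp_insert' a fun h => hns (hYs h)]
        refine hY _ (Finset.insert_subset_insert n hYs) ?_
        convert hne using 5
        ext i
        simp only [Finset.mem_insert]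
        grind
      · intro c hcs hind hspan
        have h := hc c (hcs.trans (Finset.subset_insert n s)) hind hspan
        have h0 : {j | j ∈ c ∧ n ≤ j} = (∅ : Set (Fin N)) := by
          ext j
          simp only [Set.mem_ofPred_eq, Set.mem_empty_iff_false, iff_false, not_and, not_le]
          exact fun hj => hn j (hcs hj)
        rw [Finset.filter_insert, if_pos (by rw [h0]; simpa using haW),
          diffOp_insert' a (by simp [hns])] at h
        exact h
    -- Contraction: `p` is now killed by derivatives along `W` and `a n`.
    refine ih (W ⊔ Submodule.span K {a n}) p ?_ ?_ ?_
    · intro w hw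
      obtain ⟨w', hw', y, hy, rfl⟩ := Submodule.mem_sup.1 hw
      obtain ⟨t, rfl⟩ := Submodule.mem_span_singleton.1 hy
      rw [dirDeriv_add, dirDeriv_smul, hW w' hw', hq, smul_zero, add_zero]
    · intro Y hYs hne
      refine hY Y (hYs.trans (Finset.subset_insert n s)) ?_
      have : {i | i ∈ insert n s ∧ i ∉ Y} = insert n {i | i ∈ s ∧ i ∉ Y} := by
        ext i
        simp only [Finset.mem_insert, Set.mem_ofPred_eq, Set.mem_insert_iff]
        grind
      rwa [this, Set.image_insert_eq, Submodule.span_insert, ← sup_assoc]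
    · intro c hcs hind hspan
      have hnc : n ∉ c := fun h => hns (hcs h)
      by_cases haW : a n ∈ W
      · have hWeq : W ⊔ Submodule.span K {a n} = W :=
          sup_eq_left.2 (by simpa using haW)
        rw [hWeq] at hind hspan ⊢
        have h := hc c (hcs.trans (Finset.subset_insert n s)) hind hspan
        rwa [Finset.filter_insert, if_neg (by
          rw [not_not]; exact Submodule.mem_sup_left haW)] at h
      -- Since `n` is the maximum, every tail of `insert n c` that starts at a position of `s`
      -- contains `n`. Contracting by `a n` therefore leaves the breaking positions in `s`
      -- unchanged.
      · have hsplit : ∀ P : Fin N → Prop, P n →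
            W ⊔ Submodule.span K (a '' {j | j ∈ insert n c ∧ P j}) =
              W ⊔ Submodule.span K {a n} ⊔ Submodule.span K (a '' {j | j ∈ c ∧ P j}) := by
          intro P hP
          have : {j | j ∈ insert n c ∧ P j} = insert n {j | j ∈ c ∧ P j} := by
            ext i
            simp only [Finset.mem_insert, Set.mem_ofPred_eq, Set.mem_insert_iff]
            grind
          rw [this, Set.image_insert_eq, Submodule.span_insert, ← sup_assoc]
        have h := hc (insert n c) (Finset.insert_subset_insert n hcs) ?_ ?_
        · rw [Finset.filter_insert, if_neg (by
            rw [not_not, hsplit _ le_rfl]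
            exact Submodule.mem_sup_left
              (Submodule.mem_sup_right (Submodule.mem_span_singleton_self _)))] at h
          rw [← h]
          congr 3
          refine Finset.filter_congr fun i hi => ?_
          rw [hsplit _ (hn i hi).le]
        · intro i hi
          rcases Finset.mem_insert.1 hi with rfl | hi
          · have h0 : {j | j ∈ insert i c ∧ i < j} = (∅ : Set (Fin N)) := by
              ext j
              simp only [Finset.mem_insert, Set.mem_ofPred_eq, Set.mem_empty_iff_false, iff_false,
                not_and, not_lt]
              rintro (rfl | hj)
              · exact le_rfl
              · exact (hn j (hcs hj)).le
            rw [h0]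
            simpa using haW
          · rw [hsplit _ (hn i (hcs hi))]
            exact hind i hi
        · have := hsplit (fun _ => True) trivial
          simp only [and_true] at this
          rw [this, hspan]

/-- An element `p` of `D(X)` is determined by the constant terms of `D_Y p`, where `Y` runs over
the non-breaking sublists of the bases. -/
theorem eq_zero_of_forall_basis [CharZero K] [FiniteDimensional K U]
    {a : Fin N → Module.Dual K U} (h0 : ∀ i, a i ≠ 0) {p : SymmetricAlgebra K U}
    (hp : p ∈ DSpace a)
    (h : ∀ b ∈ bases K a, algebraMapInv (diffOp a (nonBreaking K a b) p) = 0) : p = 0 := by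
  classical
  refine eq_zero_of_forall_relative_basis a Finset.univ ⊥ p ?_ ?_ ?_
  · intro w hw
    rw [(Submodule.mem_bot K).1 hw, dirDeriv_zero]
  · intro Y _ hY
    exact hp Y (by simpa [IsCocircuit] using hY)
  · intro c _ hind hspan
    simp only [bot_sup_eq] at hind hspan ⊢
    have hb : c ∈ bases K a := mem_bases.2 ⟨linearIndepOn_of_notMem_span_gt a c hind, hspan⟩
    rw [← h c hb, nonBreaking]
    congr 3
    refine Finset.filter_congr fun i _ => ?_
    rw [breaks_iff_mem_span (h0 i)]

variable (K) in
/-- The constant terms of `D_Y p`, for the non-breaking sublists `Y` of the bases. -/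
noncomputable def basisValues (a : Fin N → Module.Dual K U) :
    SymmetricAlgebra K U →ₗ[K] (bases K a → K) :=
  LinearMap.pi fun b => algebraMapInv.toLinearMap ∘ₗ diffOp a (nonBreaking K a b)

theorem basisValues_injective [CharZero K] [FiniteDimensional K U]
    {a : Fin N → Module.Dual K U} (h0 : ∀ i, a i ≠ 0) :
    Function.Injective (basisValues K a ∘ₗ (DSpace a).subtype) := by
  rw [injective_iff_map_eq_zero]
  intro p hp
  exact Subtype.ext (eq_zero_of_forall_basis h0 p.2 fun b hb => congrFun hp ⟨b, hb⟩)

theorem finiteDimensional_DSpace [CharZero K] [FiniteDimensional K U]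
    {a : Fin N → Module.Dual K U} (h0 : ∀ i, a i ≠ 0) : FiniteDimensional K (DSpace a) :=
  Module.Finite.of_injective _ (basisValues_injective h0)

theorem finrank_DSpace_le [CharZero K] [FiniteDimensional K U]
    {a : Fin N → Module.Dual K U} (h0 : ∀ i, a i ≠ 0) :
    Module.finrank K (DSpace a) ≤ (bases K a).card := by
  simpa using LinearMap.finrank_le_finrank_of_injective (basisValues_injective h0)

/-- With fewer than `k` derivatives the result is homogeneous of positive degree; with more it
vanishes. -/
theorem basisValues_eq_zero_of_mem_homogeneousPart {a : Fin N → Module.Dual K U} {k : ℕ}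
    {p : SymmetricAlgebra K U} (hp : p ∈ homogeneousPart K U k) (b : bases K a)
    (hb : (nonBreaking K a b).card ≠ k) : basisValues K a p b = 0 := by
  change algebraMapInv (diffOp a (nonBreaking K a b) p) = 0
  rcases lt_or_gt_of_ne hb with hlt | hgt
  · obtain ⟨m, rfl⟩ := Nat.exists_eq_add_of_lt hlt
    refine algebraMapInv_of_mem_homogeneousPart (Nat.succ_ne_zero m)
      (diffOp_mem_homogeneousPart a _ ?_)
    rwa [show m.succ + (nonBreaking K a b).card = (nonBreaking K a b).card + m + 1 by omega]
  · rw [diffOp_eq_zero_of_lt_card a hgt hp, map_zero]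

theorem finrank_DSpacePart_le [CharZero K] [FiniteDimensional K U]
    {a : Fin N → Module.Dual K U} (h0 : ∀ i, a i ≠ 0) (k : ℕ) :
    Module.finrank K (DSpacePart a k) ≤
      ((bases K a).filter fun b => N - breakCount K a b = k).card := by
  let B := (bases K a).filter fun b => N - breakCount K a b = k
  let f : DSpacePart a k →ₗ[K] (B → K) :=
    LinearMap.funLeft K K (fun b : B => (⟨b, (Finset.mem_filter.1 b.2).1⟩ : bases K a)) ∘ₗ
      basisValues K a ∘ₗ (DSpace a).subtype ∘ₗ (DSpacePart a k).subtype
  have hf : Function.Injective f := by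
    rw [injective_iff_map_eq_zero]
    intro p hp
    refine Subtype.ext ((injective_iff_map_eq_zero _).1 (basisValues_injective h0) _ ?_)
    funext b
    by_cases hb : N - breakCount K a b = k
    · exact congrFun hp ⟨b, Finset.mem_filter.2 ⟨b.2, hb⟩⟩
    · exact basisValues_eq_zero_of_mem_homogeneousPart p.2 b (by rwa [card_nonBreaking])
  have h := LinearMap.finrank_le_finrank_of_injective hf
  rwa [Module.finrank_fintype_fun_eq_card, Fintype.card_coe] at h

end UpperBound

end DahmenMicchelli

namespace DahmenMicchelli

open SymmetricAlgebra

/-! ### Formal exponentials and their least-degree parts. -/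

section Exponentials

variable {K U : Type*} [Field K] [AddCommGroup U] [Module K U] {κ : Type*} [Fintype κ]

/-- The degree `k` part `∑ f_b u_b ^ k / k!` of the combination `∑ f_b exp(u_b)` of formal
exponentials. -/
noncomputable def expPart (u : κ → U) (k : ℕ) : (κ → K) →ₗ[K] SymmetricAlgebra K U :=
  Fintype.linearCombination K fun b => (k.factorial : K)⁻¹ • ι K U (u b) ^ k

theorem expPart_apply (u : κ → U) (k : ℕ) (f : κ → K) :
    expPart u k f = ∑ b, f b • (k.factorial : K)⁻¹ • ι K U (u b) ^ k := rfl

theorem expPart_mem_homogeneousPart (u : κ → U) (k : ℕ) (f : κ → K) :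
    expPart u k f ∈ homogeneousPart K U k :=
  Submodule.sum_mem _ fun b _ => Submodule.smul_mem _ _ (Submodule.smul_mem _ _
    (Submodule.pow_mem_pow _ (LinearMap.mem_range_self _ (u b)) k))

theorem dirDeriv_expPart [CharZero K] (v : Module.Dual K U) (u : κ → U) (k : ℕ) (f : κ → K) :
    dirDeriv v (expPart u (k + 1) f) = expPart u k fun b => v (u b) * f b := by
  rw [expPart_apply, expPart_apply, map_sum]
  refine Finset.sum_congr rfl fun b _ => ?_
  have hk : ((k + 1 : ℕ) : K) ≠ 0 := Nat.cast_ne_zero.2 (Nat.succ_ne_zero k)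
  have hf : (k.factorial : K) ≠ 0 := Nat.cast_ne_zero.2 (Nat.factorial_ne_zero k)
  rw [Derivation.map_smul, Derivation.map_smul, Derivation.leibniz_pow, dirDeriv_ι,
    Nat.add_sub_cancel, smul_eq_mul, mul_comm, ← Algebra.smul_def, ← Nat.cast_smul_eq_nsmul K,
    smul_smul, smul_smul, smul_smul, smul_smul, Nat.factorial_succ, Nat.cast_mul]
  congr 1
  field_simp

theorem diffOp_expPart [CharZero K] {N : ℕ} (a : Fin N → Module.Dual K U) (u : κ → U)
    (Z : Finset (Fin N)) (m : ℕ) (f : κ → K) :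
    diffOp a Z (expPart u (m + Z.card) f) =
      expPart u m fun b => (∏ i ∈ Z, a i (u b)) * f b := by
  induction Z using Finset.induction_on generalizing f with
  | empty => simp [diffOp_empty]
  | insert i Z hi ih =>
    rw [diffOp_insert' a hi, Finset.card_insert_of_notMem hi, ← add_assoc, dirDeriv_expPart, ih]
    congr 1
    funext b
    rw [Finset.prod_insert hi]
    ring

/-- The least part of a combination of exponentials inherits the equations
`∏ (D_{a_i} - c_i) f = 0` with the constants `c_i` replaced by `0`. -/
theorem diffOp_expPart_eq_zero [CharZero K] {N : ℕ} (a : Fin N → Module.Dual K U)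
    (u : κ → U) (c : Fin N → K) (Y : Finset (Fin N))
    (hY : ∀ b, ∃ i ∈ Y, a i (u b) = c i) {k : ℕ} {f : κ → K}
    (hf : ∀ j < k, expPart u j f = 0) : diffOp a Y (expPart u k f) = 0 := by
  rcases lt_or_ge k Y.card with hk | hk
  · exact diffOp_eq_zero_of_lt_card a hk (expPart_mem_homogeneousPart u k f)
  obtain ⟨m, rfl⟩ := Nat.exists_eq_add_of_le' hk
  -- This is the degree `m` part of `∏ (D_{a_i} - c_i)` applied to the combination. Terms with `Z ≠
  -- Y` involve only degrees below `k`, which vanish by `hf`.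
  have hexpand : expPart u m (fun b => (∏ i ∈ Y, (a i (u b) + -c i)) * f b) =
      ∑ Z ∈ Y.powerset, (∏ i ∈ Y \ Z, -c i) • diffOp a Z (expPart u (m + Z.card) f) := by
    simp only [diffOp_expPart, ← map_smul, ← map_sum]
    congr 1
    funext b
    rw [Finset.prod_add, Finset.sum_mul, Finset.sum_apply]
    exact Finset.sum_congr rfl fun Z _ => by simp only [Pi.smul_apply, smul_eq_mul]; ring
  have hzero : (fun b => (∏ i ∈ Y, (a i (u b) + -c i)) * f b) = 0 := by
    funext b
    obtain ⟨i, hi, h⟩ := hY b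
    rw [Finset.prod_eq_zero hi (by rw [h, add_neg_cancel]), zero_mul, Pi.zero_apply]
  rw [hzero, map_zero, Finset.sum_eq_single Y] at hexpand
  · simpa using hexpand.symm
  · intro Z hZ hne
    have hlt : Z.card < Y.card :=
      Finset.card_lt_card ((Finset.mem_powerset.1 hZ).ssubset_of_ne hne)
    rw [hf _ (by omega), map_zero, smul_zero]
  · simp

/-- The functionals that identify two given points form a proper subspace, and finitely many proper
subspaces cannot cover the dual over an infinite field. -/
theorem exists_dual_injective [Infinite K] {u : κ → U} (hu : Function.Injective u) :
    ∃ v : Module.Dual K U, Function.Injective fun b => v (u b) := by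
  let p : {x : κ × κ // x.1 ≠ x.2} → Submodule K (Module.Dual K U) := fun x =>
    LinearMap.ker (Module.Dual.eval K U (u x.1.1 - u x.1.2))
  by_contra! h
  obtain ⟨⟨⟨b, b'⟩, hne⟩, hx⟩ := Subspace.exists_eq_top_of_iUnion_eq_univ (p := p) (by
    refine Set.eq_univ_of_forall fun v => ?_
    obtain ⟨b, b', hb, hne⟩ := Function.not_injective_iff.1 (h v)
    refine Set.mem_iUnion.2 ⟨⟨(b, b'), hne⟩, ?_⟩
    change v (u b - u b') = 0
    rw [map_sub, sub_eq_zero]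
    exact hb)
  refine hne (hu (sub_eq_zero.1 ((Module.forall_dual_apply_eq_zero_iff K _).1 fun v => ?_)))
  have hv : v ∈ p ⟨(b, b'), hne⟩ := hx ▸ Submodule.mem_top
  exact hv

/-- Formal exponentials of distinct vectors are linearly independent. -/
theorem eq_zero_of_forall_expPart_eq_zero [CharZero K] {u : κ → U} (hu : Function.Injective u)
    {f : κ → K} (hf : ∀ j < Fintype.card κ, expPart u j f = 0) : f = 0 := by
  obtain ⟨v, hv⟩ := exists_dual_injective (K := K) hu
  let e := Fintype.equivFin κ
  -- Evaluation at `v` turns the hypotheses into a Vandermonde system with distinct nodes `v (u b)`.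
  have h := Matrix.eq_zero_of_forall_pow_sum_mul_pow_eq_zero
    (f := fun i => v (u (e.symm i))) (v := fun i => f (e.symm i))
    (hv.comp e.symm.injective) fun j => by
      have h1 := congrArg (SymmetricAlgebra.lift v) (hf j j.2)
      rw [expPart_apply, map_sum, map_zero, ← e.symm.sum_comp] at h1
      simp only [map_smul, map_pow, lift_ι_apply, smul_eq_mul] at h1
      have hk : ((j : ℕ).factorial : K) ≠ 0 := Nat.cast_ne_zero.2 (Nat.factorial_ne_zero _)
      rw [Finset.sum_congr rfl fun i _ => mul_left_comm _ _ _, ← Finset.mul_sum] at h1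
      exact (mul_eq_zero.1 h1).resolve_left (inv_ne_zero hk)
  funext b
  simpa using congrFun h (e b)

end Exponentials

/-! ### Lower bound from generic intersection points. -/

section LowerBound

variable {K U : Type*} [Field K] [AddCommGroup U] [Module K U] {N : ℕ}
  {a : Fin N → Module.Dual K U}

/-- `P c` comes from the basis of `U` dual to `b`. Its linearity in `c` and its independence of the
coordinates outside `b` make the non-generic constants a union of proper subspaces. -/
theorem IsBasisOf.exists_common_point [FiniteDimensional K U] {b : Finset (Fin N)}
    (hb : IsBasisOf (K := K) a b) :
    ∃ P : (Fin N → K) →ₗ[K] U, (∀ c, ∀ i ∈ b, a i (P c) = c i) ∧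
      ∀ j ∉ b, P (Pi.single j 1) = 0 := by
  have hspan : Submodule.span K (Set.range fun i : b => a i) = ⊤ := by
    rw [← hb.2]
    congr 1
    ext v
    simp
  let B := Module.Basis.mk hb.1 hspan.ge
  let w : b → U := fun i => (Module.evalEquiv K U).symm (B.coord i)
  have hw : ∀ i j : b, a i (w j) = if i = j then 1 else 0 := by
    intro i j
    have h : a i (w j) = B.coord j (a i) := by
      have := LinearMap.congr_fun ((Module.evalEquiv K U).apply_symm_apply (B.coord j)) (a i)
      exact this
    have hi : a i = B i := (Module.Basis.mk_apply hb.1 hspan.ge i).symm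
    rw [h, hi, Module.Basis.coord_apply, Module.Basis.repr_self, Finsupp.single_apply]
  refine ⟨∑ i : b, (LinearMap.proj (i : Fin N)).smulRight (w i), fun c i hi => ?_, fun j hj => ?_⟩
  · rw [LinearMap.sum_apply, map_sum, Finset.sum_eq_single ⟨i, hi⟩]
    · simp [hw ⟨i, hi⟩ ⟨i, hi⟩]
    · intro j _ hj
      simp [hw ⟨i, hi⟩ j, hj.symm]
    · simp
  · rw [LinearMap.sum_apply]
    refine Finset.sum_eq_zero fun i _ => ?_
    have : (i : Fin N) ≠ j := fun h => hj (h ▸ i.2)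
    simp [this]

/-- For generic constants `c`, the hyperplanes `a_i = c_i` meet in distinct points for distinct
bases. -/
theorem exists_generic_points [CharZero K] [FiniteDimensional K U] :
    ∃ (c : Fin N → K) (u : bases K a → U), Function.Injective u ∧
      ∀ b : bases K a, ∀ i ∈ b.1, a i (u b) = c i := by
  choose P hP hP0 using fun b : bases K a => (mem_bases.1 b.2).exists_common_point
  -- The bad constants for `(b, j)`: the point of `b` also lies on the hyperplane of some `j ∉ b`.
  -- The coordinate vector at `j` is never bad, so this subspace is proper.
  let p : {x : bases K a × Fin N // x.2 ∉ x.1.1} → Submodule K (Fin N → K) := fun x =>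
    LinearMap.ker (LinearMap.proj x.1.2 - a x.1.2 ∘ₗ P x.1.1)
  suffices h : ∃ c : Fin N → K, ∀ x, c ∉ p x by
    obtain ⟨c, hc⟩ := h
    refine ⟨c, fun b => P b c, fun b b' hbb => ?_, fun b => hP b c⟩
    have key : ∀ b b' : bases K a, P b c = P b' c → b'.1 ⊆ b.1 := by
      intro b b' hbb j hj
      by_contra hjb
      refine hc ⟨(b, j), hjb⟩ ?_
      change c j - a j (P b c) = 0
      rw [hbb, hP b' c j hj, sub_self]
    exact Subtype.ext (Finset.Subset.antisymm (key b' b hbb.symm) (key b b' hbb))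
  by_contra! h
  obtain ⟨⟨⟨b, j⟩, hj⟩, hx⟩ := Subspace.exists_eq_top_of_iUnion_eq_univ (p := p)
    (Set.eq_univ_of_forall fun c => Set.mem_iUnion.2 (h c))
  have hmem : Pi.single j 1 ∈ p ⟨(b, j), hj⟩ := hx ▸ Submodule.mem_top
  have h1 : (Pi.single j 1 : Fin N → K) j - a j (P b (Pi.single j 1)) = 0 := hmem
  rw [hP0 b j hj, map_zero, Pi.single_eq_same, sub_zero] at h1
  exact one_ne_zero h1

theorem IsCocircuit.exists_mem_of_isBasisOf {V : Type*} [AddCommGroup V] [Module K V]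
    {a : Fin N → V} {Y b : Finset (Fin N)}
    (hY : IsCocircuit (K := K) a Y) (hb : IsBasisOf (K := K) a b) : ∃ i ∈ Y, i ∈ b := by
  by_contra! h
  exact hY (eq_top_iff.2 (hb.2 ▸ Submodule.span_mono
    (Set.image_mono fun i hi hiY => h i hiY hi)))

theorem card_bases_le_sum_finrank [CharZero K] [FiniteDimensional K U]
    [FiniteDimensional K (DSpace a)] {M : ℕ} (hM : (bases K a).card ≤ M) :
    (bases K a).card ≤ ∑ k ∈ Finset.range M, Module.finrank K (DSpacePart a k) := by
  obtain ⟨c, u, hu, hc⟩ := exists_generic_points (a := a)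
  -- `E k` holds the combinations of exponentials vanishing below degree `k`. Taking degree `k`
  -- parts maps `E k` to `D_k(X)` with kernel `E (k + 1)`.
  let E : ℕ → Submodule K (bases K a → K) := fun k =>
    ⨅ j : Fin k, LinearMap.ker (expPart u j)
  have hE : ∀ k f, f ∈ E k ↔ ∀ j < k, expPart u j f = 0 := by
    intro k f
    simp only [E, Submodule.mem_iInf, LinearMap.mem_ker]
    exact ⟨fun h j hj => h ⟨j, hj⟩, fun h j => h j j.2⟩
  have hD : ∀ k f, f ∈ E k → expPart u k f ∈ DSpace a := by
    intro k f hf Y hY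
    refine diffOp_expPart_eq_zero a u c Y (fun b => ?_) ((hE k f).1 hf)
    obtain ⟨i, hiY, hib⟩ := hY.exists_mem_of_isBasisOf (mem_bases.1 b.2)
    exact ⟨i, hiY, hc b i hib⟩
  have hstep : ∀ k, Module.finrank K (E k) ≤
      Module.finrank K (DSpacePart a k) + Module.finrank K (E (k + 1)) := by
    intro k
    let T : E k →ₗ[K] DSpacePart a k :=
      LinearMap.codRestrict _ (LinearMap.codRestrict _ (expPart u k ∘ₗ (E k).subtype)
        fun f => hD k f f.2) fun f => expPart_mem_homogeneousPart u k f.1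
    have hT := LinearMap.finrank_range_add_finrank_ker (V₂ := DSpacePart a k) T
    rw [← hT]
    refine add_le_add (Submodule.finrank_le _) ?_
    let g : LinearMap.ker T →ₗ[K] E (k + 1) :=
      LinearMap.codRestrict _ ((E k).subtype ∘ₗ (LinearMap.ker T).subtype) fun f => by
        refine (hE _ _).2 fun j hj => ?_
        rcases Nat.lt_succ_iff_lt_or_eq.1 hj with hj | rfl
        · exact (hE k _).1 f.1.2 j hj
        · exact congrArg (fun p => (p.1 : SymmetricAlgebra K U)) (LinearMap.mem_ker.1 f.2)
    refine LinearMap.finrank_le_finrank_of_injective (f := g) fun f f' h => ?_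
    exact Subtype.ext (Subtype.ext (congrArg (fun x : E (k + 1) => x.1) h))
  have hsum : ∀ m, (bases K a).card ≤
      ∑ k ∈ Finset.range m, Module.finrank K (DSpacePart a k) + Module.finrank K (E m) := by
    intro m
    induction m with
    | zero =>
      have : E 0 = ⊤ := by simp [E]
      rw [this, finrank_top]
      simp
    | succ m ih =>
      rw [Finset.sum_range_succ]
      have := hstep m
      omega
  have hbot : E M = ⊥ := by
    rw [eq_bot_iff]
    intro f hf
    exact (Submodule.mem_bot K).2 (eq_zero_of_forall_expPart_eq_zero hu fun j hj =>
      (hE M f).1 hf j (hj.trans_le (by simpa using hM)))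
  have h := hsum M
  rwa [hbot, finrank_bot, add_zero] at h

end LowerBound

/-! ### Equality in every degree, the direct sum and the top degree. -/

section Conclusion

variable {K U : Type*} [Field K] [AddCommGroup U] [Module K U] {N : ℕ}

theorem iSupIndep_DSpacePart (a : Fin N → Module.Dual K U) : iSupIndep (DSpacePart a) := by
  have h := iSupIndep_homogeneousPart (K := K) (U := U)
  rw [iSupIndep_iff_finsetSum_eq_zero_imp_eq_zero] at h ⊢
  intro s v hv h0 i hi
  refine Subtype.ext (h s (fun i => (v i : SymmetricAlgebra K U)) hv ?_ i hi)
  simpa using congrArg (DSpace a).subtype h0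

variable [CharZero K] [FiniteDimensional K U] {a : Fin N → Module.Dual K U}

theorem finrank_DSpacePart (h0 : ∀ i, a i ≠ 0) (k : ℕ) :
    Module.finrank K (DSpacePart a k) =
      ((bases K a).filter fun b => N - breakCount K a b = k).card := by
  have := finiteDimensional_DSpace h0
  -- Large enough for the lower bound, for all exponents `N - n(b)`, and for `k` itself.
  let M := (bases K a).card + N + k + 1
  have hlow := card_bases_le_sum_finrank (a := a) (M := M) (by omega)
  have hfib : (bases K a).card = ∑ k ∈ Finset.range M,
      ((bases K a).filter fun b => N - breakCount K a b = k).card :=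
    Finset.card_eq_sum_card_fiberwise fun b _ => by
      simp only [Finset.coe_range, Set.mem_Iio]
      omega
  refine (Finset.sum_eq_sum_iff_of_le fun k _ => finrank_DSpacePart_le h0 k).1
    (le_antisymm (Finset.sum_le_sum fun k _ => finrank_DSpacePart_le h0 k) (hfib ▸ hlow)) k
    (Finset.mem_range.2 (by omega))

theorem iSup_DSpacePart (h0 : ∀ i, a i ≠ 0) : ⨆ k, DSpacePart a k = ⊤ := by
  have := finiteDimensional_DSpace h0
  refine Submodule.eq_top_of_finrank_eq (le_antisymm (Submodule.finrank_le _) ?_)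
  -- The sum of the graded parts already has dimension at least the number of bases, which bounds
  -- `dim D(X)`.
  refine (finrank_DSpace_le h0).trans ((card_bases_le_sum_finrank le_rfl).trans ?_)
  let M := (bases K a).card
  let g : (∀ k : Fin M, DSpacePart a k) →ₗ[K] (⨆ k, DSpacePart a k : Submodule K (DSpace a)) :=
    LinearMap.codRestrict _ (∑ k : Fin M, (DSpacePart a k).subtype ∘ₗ LinearMap.proj k) fun f => by
      rw [LinearMap.sum_apply]
      exact Submodule.sum_mem _ fun k _ => Submodule.mem_iSup_of_mem (k : ℕ) (f k).2
  have hg : Function.Injective g := by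
    rw [injective_iff_map_eq_zero]
    intro f hf
    have hind : iSupIndep fun k : Fin M => DSpacePart a k :=
      (iSupIndep_DSpacePart a).comp Fin.val_injective
    rw [iSupIndep_iff_finsetSum_eq_zero_imp_eq_zero] at hind
    have hsum : ∑ k : Fin M, (f k : DSpace a) = 0 := by
      have h := congrArg Subtype.val hf
      simpa [g, LinearMap.sum_apply] using h
    funext k
    exact Subtype.ext (hind Finset.univ (fun k => f k) (fun k _ => (f k).2) hsum k
      (Finset.mem_univ k))
  have : ∀ k : Fin M, Module.Free K (DSpacePart a k) := fun k =>
    Module.Free.of_divisionRing K (DSpacePart a k)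
  have h := LinearMap.finrank_le_finrank_of_injective hg
  rwa [Module.finrank_pi_fintype,
    Fin.sum_univ_eq_sum_range (fun k => Module.finrank K (DSpacePart a k))] at h

theorem hilbertSeries_eq (h0 : ∀ i, a i ≠ 0) :
    hilbertSeries a =
      ∑ b ∈ bases K a, (PowerSeries.X : PowerSeries ℕ) ^ (N - breakCount K a b) := by
  ext k
  rw [hilbertSeries, PowerSeries.coeff_mk, finrank_DSpacePart h0, map_sum, Finset.card_filter]
  refine Finset.sum_congr rfl fun b _ => ?_
  rw [PowerSeries.coeff_X_pow]
  simp only [eq_comm]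

theorem DSpacePart_ne_bot_iff (h0 : ∀ i, a i ≠ 0) (k : ℕ) :
    DSpacePart a k ≠ ⊥ ↔ ∃ b, IsBasisOf (K := K) a b ∧ N - breakCount K a b = k := by
  have := finiteDimensional_DSpace h0
  rw [ne_eq, ← Submodule.finrank_eq_zero (R := K), finrank_DSpacePart h0, Finset.card_eq_zero,
    ← ne_eq, ← Finset.nonempty_iff_ne_empty]
  simp only [Finset.Nonempty, Finset.mem_filter, mem_bases]

theorem isGreatest_degree (h0 : ∀ i, a i ≠ 0) (ha : Submodule.span K (Set.range a) = ⊤) :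
    IsGreatest {k : ℕ | DSpacePart a k ≠ ⊥} (N - Module.finrank K U) := by
  constructor
  · obtain ⟨b, hb, hcount⟩ := exists_isBasisOf_breakCount_eq h0 ha
    refine (DSpacePart_ne_bot_iff h0 _).2 ⟨b, hb, ?_⟩
    rw [hcount, hb.card_eq, Subspace.dual_finrank_eq]
  · intro k hk
    obtain ⟨b, hb, rfl⟩ := (DSpacePart_ne_bot_iff h0 _).1 hk
    have := card_le_breakCount (K := K) (a := a) b
    rw [hb.card_eq, Subspace.dual_finrank_eq] at this
    omega

end Conclusion

end DahmenMicchelli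

theorem mainTheorem3 {K U : Type*} [Field K] [CharZero K] [AddCommGroup U] [Module K U]
    [FiniteDimensional K U] {N : ℕ} (X : Fin N → Module.Dual K U)
    (hX0 : ∀ i, X i ≠ 0) (hX : Submodule.span K (Set.range X) = ⊤) :
    FiniteDimensional K (DahmenMicchelli.DSpace X) ∧
    DirectSum.IsInternal (DahmenMicchelli.DSpacePart X) ∧
    DahmenMicchelli.hilbertSeries X =
      ∑ b ∈ DahmenMicchelli.bases K X,
        (PowerSeries.X : PowerSeries ℕ) ^ (N - DahmenMicchelli.breakCount K X b) ∧
    Module.finrank K U ≤ N ∧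
    IsGreatest {k : ℕ | DahmenMicchelli.DSpacePart X k ≠ ⊥} (N - Module.finrank K U) := by
  refine ⟨DahmenMicchelli.finiteDimensional_DSpace hX0, ?_,
    DahmenMicchelli.hilbertSeries_eq hX0, ?_, DahmenMicchelli.isGreatest_degree hX0 hX⟩
  · exact DirectSum.isInternal_submodule_of_iSupIndep_of_iSup_eq_top
      (DahmenMicchelli.iSupIndep_DSpacePart X) (DahmenMicchelli.iSup_DSpacePart hX0)
  · have h := finrank_range_le_card (R := K) X
    rw [Set.finrank, hX, finrank_top, Subspace.dual_finrank_eq, Fintype.card_fin] at h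
    exact h
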